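/- **Theorem 2.** Let $n,k,d,e$ be integers with $e\ge 1$, $1\le k\le d$ and $d+e\le n$, let $\alpha,\beta\ge 0$ and $\mathcal M$ be real numbers, and write $k=\eta e+r$ with $\eta=\lfloor k/e\rfloor$, $0\le r<e$. Let $$\mathcal P=\Big\{\mathbf u=[u_1,\dots,u_g]\;:\; g\in\mathbb N,\ u_i\in\mathbb Z,\ 1\le u_i\le e,\ \sum_{i=1}^g u_i=k\Big\},\qquad f(\mathbf u)=\sum_{i=1}^{g}\min\Big(u_i\alpha,\ \big(d-\sum_{j=1}^{i-1}u_j\big)\beta\Big).$$ *Model.* A data object $w$ from a finite set $W$ is stored on $n$ nodes, the content of node $i$ being $c_i(w)\in X$; the family $c=(c_i)_{i\le n}$ is called a code. A code has the reconstruction property if $w$ can be decoded from the contents of any $k$ nodes. A centralized repair of a set $E$ of $e$ failed nodes by a set $H$ of $d$ other nodes replaces $c$ by a code $c'$ with $c'_i=c_i$ for $i\notin E$, where each helper in $H$ sends an element of a set $S$, computed from its content, to a central node, which computes the contents of all nodes in $E$ from the $d$ elements received. A code sustains $0$ rounds of (functional) repair if it has the reconstruction property, and it sustains $T+1$ rounds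 if it has the reconstruction property and, for any $E$ and $H$ as above, some centralized repair leads to a code that sustains $T$ rounds. An exact $(\mathcal M,n,k,d,e,\alpha,\beta)$ code for $T$ rounds is a code that sustains $T$ rounds, with finite alphabets such that $|W|\ge b^{\mathcal M}$, $|X|\le b^{\alpha}$, $|S|\le b^{\beta}$ for some real $b>1$ (the unit of information). Functional regenerating codes with parameters $(\mathcal M,n,k,d,e,\alpha,\beta)$ are said to exist for $T$ rounds if for every $\varepsilon>0$ there is an exact $(\mathcal M-\varepsilon,n,k,d,e,\alpha,\beta)$ code for $T$ rounds. *Result.* Put $$\mathbf u^*=\begin{cases}[k], & \text{if } k\le e,\\ [\underbrace{e,\dots,e}_{\eta}], & \text{else if } k=\eta e,\\ [r,\underbrace{e,\dots,e}_{\eta}], & \text{else if } \alpha\le \frac{d+\eta r-\eta e}{r}\,\beta,\\ [\underbrace{e,\dots,e}_{\eta},r], & \text{otherwise.}\end{cases}$$ Then $\mathbf u^*\in\mathcal P$, it has $\lceil k/e\rceil$ entries, and $f(\mathbf u^*)=\min_{\mathbf u\in\mathcal P}f(\mathbf u)$. Moreover, for every bound $T\ge\lceil k/e\rceil$ on the number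 of repair rounds, functional regenerating codes with parameters $(\mathcal M,n,k,d,e,\alpha,\beta)$ exist for $T$ rounds if and only if $\mathcal M\le f(\mathbf u^*)$. If $\mathcal M,\alpha,\beta$ are non-negative integer multiples of one positive real number, then also an exact $(\mathcal M,n,k,d,e,\alpha,\beta)$ code for $T$ rounds exists if and only if $\mathcal M\le f(\mathbf u^*)$. -/

import Mathlib

noncomputable section

namespace CentralizedRepair

/-! ### Recovery scenarios and the cut function -/

/-- The set of recovery scenarios: finite vectors `[u₁, …, u_g]` of integers with
`1 ≤ uᵢ ≤ e` and `u₁ + ⋯ + u_g = k`. -/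
def scenarios (k e : ℕ) : Set (List ℕ) :=
  {u | (∀ x ∈ u, 1 ≤ x ∧ x ≤ e) ∧ u.sum = k}

/-- The cut value `f(u) = ∑ᵢ min (uᵢ α, (d - ∑_{j < i} uⱼ) β)`
(here `i` runs from `0`, and the subtraction is the one of `ℝ`). -/
def cutValue (d : ℕ) (α β : ℝ) (u : List ℕ) : ℝ :=
  ∑ i : Fin u.length,
    min ((u.get i : ℝ) * α) (((d : ℝ) - ((u.take (i : ℕ)).sum : ℝ)) * β)

/-- The scenario `u*`, where `η = ⌊k / e⌋` and `r = k - η e`. -/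
def optimalScenario (k d e : ℕ) (α β : ℝ) : List ℕ :=
  let η : ℕ := k / e
  let r : ℕ := k % e
  if k ≤ e then [k]
  else if k = η * e then List.replicate η e
  else if α ≤ ((d : ℝ) + (η : ℝ) * (r : ℝ) - (η : ℝ) * (e : ℝ)) / (r : ℝ) * β then
    r :: List.replicate η e
  else List.replicate η e ++ [r]

/-! ### Functional regenerating codes with centralized repair

`W` is the set of possible data objects, `X` the alphabet of the content of a storage node, and
`S` the alphabet of what one helper sends in one repair.  A code, at a given time, is the family
`c : Fin n → W → X` of maps that give the present content of each of the `n` nodes as a function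
of the stored data object. -/

section Codes

variable {n : ℕ} {W X : Type}

/-- Reconstruction property: from the contents of any `k` nodes the data object can be
decoded. -/
def Reconstructs (k : ℕ) (c : Fin n → W → X) : Prop :=
  ∀ K : Finset (Fin n), K.card = k →
    ∃ decode : (K → X) → W, ∀ w : W, decode (fun i => c i w) = w

/-- `c'` arises from `c` by one centralized repair of the failed nodes `E` with helpers `H`: the
other nodes are unchanged, every helper sends to the central node an element of `S` computed from
its own content, and the central node computes from what it receives the contents of all the
replacement nodes. -/
def IsRepair (S : Type) (E H : Finset (Fin n)) (c c' : Fin n → W → X) : Prop :=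
  (∀ i, i ∉ E → c' i = c i) ∧
    ∃ (send : H → X → S) (regenerate : (H → S) → E → X),
      ∀ (i : E) (w : W), c' i w = regenerate (fun j => send j (c j w)) i

/-- The code `c` has the reconstruction property and keeps it through `T` successive rounds of
functional repair: for any `e` failed nodes and any `d` helpers among the other nodes there is a
repair after which the new code has the same property for the `T - 1` remaining rounds. -/
def Sustains (k d e : ℕ) (S : Type) : ℕ → (Fin n → W → X) → Prop
  | 0, c => Reconstructs k c
  | T + 1, c => Reconstructs k c ∧
      ∀ E H : Finset (Fin n), E.card = e → H.card = d → Disjoint E H →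
        ∃ c' : Fin n → W → X, IsRepair S E H c c' ∧ Sustains k d e S T c'

end Codes

/-- There is a functional regenerating code for `n` nodes, sustaining `T` rounds of centralized
repair of `e` nodes by `d` helpers, that stores an amount of information at least `M`, at most `α`
per node, with at most `β` downloaded from each helper.  An alphabet of size `N` holds the amount
`log_b N` of information; the unit of information, that is the base `b > 1`, is arbitrary. -/
def ExactCodeExists (M : ℝ) (n k d e : ℕ) (α β : ℝ) (T : ℕ) : Prop :=
  ∃ b : ℝ, 1 < b ∧ ∃ w x s : ℕ,
    b ^ M ≤ (w : ℝ) ∧ (x : ℝ) ≤ b ^ α ∧ (s : ℝ) ≤ b ^ β ∧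
      ∃ c : Fin n → Fin w → Fin x, Sustains k d e (Fin s) T c

/-- Existence of codes for real amounts of information, in the usual sense of network information
theory: every amount smaller than `M` can be stored.  (Alphabet sizes are integers, so that
incommensurable real amounts `α`, `β` cannot both be used up completely by a code.) -/
def CodesExist (M : ℝ) (n k d e : ℕ) (α β : ℝ) (T : ℕ) : Prop :=
  ∀ ε : ℝ, 0 < ε → ExactCodeExists (M - ε) n k d e α β T

end CentralizedRepair

end

/-!
The optimal scenario is found by concavity. In a scenario starting with a part `u` and continued by
an extreme one (`[r, e, …, e]` or `[e, …, e, r]`), the cut value is concave in `u` when `u + r` is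
fixed, so `u` and `r` may be merged until one of them is `0` or `e`
(`min_le_part_then_front`, `min_le_part_then_back`). By induction every scenario has at least the
cut value of one of the two extreme scenarios (`min_frontCut_backCut_le_cutFrom`), and these two are
compared directly (`frontCut_le_backCut`, `backCut_le_frontCut`).

Necessity is the cut-set bound (`card_le_ncard_mul_rpow_cutFrom`). Let an adversary grow a set `D`
of nodes: in round `i` it lets `e` nodes outside `D` fail, makes all of `D` help, and adds `uᵢ` of
the new nodes to `D`. This multiplies the number of possible contents of `D` by at most the
exponential of the `i`-th term of the cut value, and after the last round `D` determines the data.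

Sufficiency is proved with linear codes over a large prime field, where node `i` stores the values
of `a` linear forms on the `m`-dimensional data space. Let `g y` be the minimum of the cut values of
the scenarios for `y` nodes. If `m ≤ g k`, then repairs can preserve the invariant that any `y`
nodes have joint rank at least `min m (g (min y k))`, which is the reconstruction property for
`y = k`. Indeed, if helpers send generic combinations of their contents and the new nodes store
generic combinations of the messages, the resulting ranks are given by Rado's formula
(`exists_generic_vectors`), and the invariant survives (`exists_repair_vectors`) because appending
a part to a scenario gives `g (y + u) ≤ g y + min (u a) ((d - y) b)` for `u ≤ e`. Genericity only
means avoiding a bounded number of proper subspaces, so that one field serves for all rounds.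

Real amounts are rounded down to multiples of a small quantity, which changes the cut values by
little (`cutFrom_sub_le`).
-/

noncomputable section

namespace CentralizedRepair

/-! ### Cut values and the optimal scenario -/

/-- The cut value of a scenario of which the first part sees `D` helpers, for a real number `D`,
by recursion on the scenario. -/
def cutFrom (α β : ℝ) : ℝ → List ℕ → ℝ
  | _, [] => 0
  | D, u :: us => min ((u : ℝ) * α) (D * β) + cutFrom α β (D - u) us

theorem sum_min_eq_cutFrom (α β : ℝ) (u : List ℕ) (D : ℝ) :
    ∑ i : Fin u.length,
      min ((u.get i : ℝ) * α) ((D - ((u.take (i : ℕ)).sum : ℝ)) * β) = cutFrom α β D u := by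
  induction u generalizing D with
  | nil => simp [cutFrom]
  | cons x us ih =>
    rw [cutFrom, ← ih]
    simp only [List.length_cons]
    rw [Fin.sum_univ_succ]
    simp [sub_sub]

theorem cutValue_eq_cutFrom (d : ℕ) (α β : ℝ) (u : List ℕ) :
    cutValue d α β u = cutFrom α β d u := sum_min_eq_cutFrom α β u d

theorem cutFrom_append (α β : ℝ) (u v : List ℕ) (D : ℝ) :
    cutFrom α β D (u ++ v) = cutFrom α β D u + cutFrom α β (D - u.sum) v := by
  induction u generalizing D with
  | nil => simp [cutFrom]
  | cons x us ih => simp [cutFrom, ih, sub_sub, add_assoc]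

/-- The cut value of `j` parts of size `e`, of which the first sees `D` helpers. -/
def fullCut (α β e : ℝ) (j : ℕ) (D : ℝ) : ℝ :=
  ∑ i ∈ Finset.range j, min (e * α) ((D - i * e) * β)

theorem fullCut_succ' (α β e : ℝ) (j : ℕ) (D : ℝ) :
    fullCut α β e (j + 1) D = min (e * α) (D * β) + fullCut α β e j (D - e) := by
  rw [fullCut, Finset.sum_range_succ', add_comm, fullCut]
  simp [sub_sub, add_mul, add_comm]

theorem fullCut_succ (α β e : ℝ) (j : ℕ) (D : ℝ) :
    fullCut α β e (j + 1) D = fullCut α β e j D + min (e * α) ((D - j * e) * β) := by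
  rw [fullCut, Finset.sum_range_succ, fullCut]

theorem cutFrom_replicate (α β : ℝ) (e j : ℕ) (D : ℝ) :
    cutFrom α β D (List.replicate j e) = fullCut α β e j D := by
  induction j generalizing D with
  | zero => simp [cutFrom, fullCut]
  | succ j ih => rw [List.replicate_succ, cutFrom, ih, fullCut_succ']

/-- The cut value of `[r, e, …, e]`, with `j` parts of size `e`. -/
def frontCut (α β e : ℝ) (j : ℕ) (r D : ℝ) : ℝ :=
  min (r * α) (D * β) + fullCut α β e j (D - r)

/-- The cut value of `[e, …, e, r]`, with `j` parts of size `e`. -/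
def backCut (α β e : ℝ) (j : ℕ) (r D : ℝ) : ℝ :=
  fullCut α β e j D + min (r * α) ((D - j * e) * β)

section Comparison

variable {α β e r D : ℝ} {j : ℕ}

/-- For large `α` every term of `[r, e, …, e]` after the first is limited by the helpers, and the
comparison becomes one of arithmetic progressions. -/
theorem backCut_le_frontCut (hβ : 0 ≤ β) (hr : 0 ≤ r) (hre : r ≤ e)
    (hD : j * e + r ≤ D) (h : (D - j * (e - r)) * β ≤ r * α) :
    backCut α β e j r D ≤ frontCut α β e j r D := by
  have hj : (0 : ℝ) ≤ j := j.cast_nonneg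
  rcases hr.eq_or_lt with rfl | hr0
  · have h1 : 0 ≤ (D - j * e) * β := mul_nonneg (by linarith) hβ
    have h2 : 0 ≤ D * β := mul_nonneg (by nlinarith) hβ
    simp [backCut, frontCut, h1, h2]
  have hcap : D * β ≤ e * α := by
    have h1 : r * D ≤ e * (D - j * (e - r)) := by nlinarith
    have h2 := mul_le_mul_of_nonneg_right h1 hβ
    have h3 : r * (D * β) ≤ r * (e * α) := by nlinarith
    exact le_of_mul_le_mul_left h3 hr0
  have hfull : ∀ j' : ℕ, fullCut α β e j' (D - r) =
      ∑ i ∈ Finset.range j', (D - i * e) * β - j' * (r * β) := by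
    intro j'
    induction j' with
    | zero => simp [fullCut]
    | succ m ih =>
      rw [fullCut_succ, ih, Finset.sum_range_succ, min_eq_right]
      · push_cast; ring
      · have : 0 ≤ (r + m * e) * β := by
          have : (0 : ℝ) ≤ m := m.cast_nonneg
          have he : 0 ≤ e := hr.trans hre
          positivity
        nlinarith
  have hback : fullCut α β e j D ≤ ∑ i ∈ Finset.range j, (D - i * e) * β :=
    Finset.sum_le_sum fun i _ => min_le_right _ _
  have hmin : (D - j * (e - r)) * β ≤ min (r * α) (D * β) := by
    refine le_min h (mul_le_mul_of_nonneg_right ?_ hβ)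
    nlinarith [mul_nonneg hj (sub_nonneg.2 hre)]
  have hlast := min_le_right (r * α) ((D - j * e) * β)
  rw [backCut, frontCut, hfull]
  nlinarith

/-- The gain `∑ (min (eα, (D - ie)β) - min (eα, (D - r - ie)β))` of a shift by `r` is at least
what a uniform distribution of the gains would give. -/
theorem le_mul_fullCut_sub (hβ : 0 ≤ β) (hr : 0 ≤ r) (hre : r ≤ e) (j : ℕ) :
    r * min (e * α - (D - r - (j - 1) * e) * β) (j * (e * β)) ≤
      e * (fullCut α β e j D - fullCut α β e j (D - r)) := by
  have he : 0 ≤ e := hr.trans hre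
  have hrβ : 0 ≤ r * β := mul_nonneg hr hβ
  induction j with
  | zero => simp [fullCut, mul_nonpos_iff, hr]
  | succ m ih =>
    rw [fullCut_succ, fullCut_succ]
    push_cast
    have hmono : fullCut α β e m (D - r) ≤ fullCut α β e m D :=
      Finset.sum_le_sum fun i _ => min_le_min le_rfl
        (mul_le_mul_of_nonneg_right (by linarith) hβ)
    have hX : (D - m * e) * β = (D - r - m * e) * β + r * β := by ring
    rw [hX]
    have hw : e * α - (D - r - ((m : ℝ) + 1 - 1) * e) * β = e * α - (D - r - m * e) * β := by ring
    rw [hw]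
    have hw' : e * α - (D - r - ((m : ℝ) - 1) * e) * β =
      e * α - (D - r - m * e) * β - e * β := by ring
    rw [hw'] at ih
    generalize (D - r - m * e) * β = X at *
    have hnn : 0 ≤ e * (fullCut α β e m D - fullCut α β e m (D - r)) :=
      mul_nonneg he (by linarith)
    by_cases hc : r * β ≤ e * α - X
    · rw [min_eq_right (a := e * α) (b := X + r * β) (by linarith),
        min_eq_right (a := e * α) (b := X) (by linarith)]
      have h1 : min (e * α - X) ((m + 1) * (e * β)) =
          min (e * α - X - e * β) (m * (e * β)) + e * β := by
        rw [← min_add_add_right]; congr 1 <;> ring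
      rw [h1]
      nlinarith
    · push Not at hc
      rw [min_eq_left (a := e * α) (b := X + r * β) (by linarith)]
      have h1 : r * min (e * α - X) ((m + 1) * (e * β)) ≤ r * (e * α - X) :=
        mul_le_mul_of_nonneg_left (min_le_left _ _) hr
      rcases le_total (e * α) X with hX0 | hX0
      · rw [min_eq_left hX0]
        nlinarith
      · rw [min_eq_right hX0]
        nlinarith

theorem frontCut_le_backCut (hβ : 0 ≤ β) (hr : 0 ≤ r) (hre : r < e)
    (hD : j * e + r ≤ D) (h : r * α ≤ (D - j * (e - r)) * β) :
    frontCut α β e j r D ≤ backCut α β e j r D := by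
  have hj : (0 : ℝ) ≤ j := j.cast_nonneg
  have he : 0 < e := hr.trans_lt hre
  have hfirst := min_le_left (r * α) (D * β)
  have hgain := le_mul_fullCut_sub (α := α) (D := D) hβ hr hre.le j
  have hmono : fullCut α β e j (D - r) ≤ fullCut α β e j D :=
    Finset.sum_le_sum fun i _ => min_le_min le_rfl
      (mul_le_mul_of_nonneg_right (by linarith) hβ)
  rw [frontCut, backCut]
  rcases le_total (r * α) ((D - j * e) * β) with hc | hc
  · rw [min_eq_left hc]; linarith
  rw [min_eq_right hc]
  suffices hs : e * (r * α - (D - j * e) * β) ≤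
      e * (fullCut α β e j D - fullCut α β e j (D - r)) by
    have := le_of_mul_le_mul_left hs he
    linarith
  refine le_trans ?_ hgain
  rw [mul_min_of_nonneg _ _ hr]
  refine le_min ?_ ?_
  · have : 0 ≤ (e - r) * (D - j * e - r) * β :=
      mul_nonneg (mul_nonneg (by linarith) (by linarith)) hβ
    nlinarith
  · nlinarith

/-- With one full part in front, the remainder can be moved to one of the two ends. -/
theorem min_le_full_then_front (hβ : 0 ≤ β) (hr : 0 ≤ r) (hre : r ≤ e)
    (hD : (j + 1) * e + r ≤ D) :
    min (frontCut α β e (j + 1) r D) (backCut α β e (j + 1) r D) ≤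
      min (e * α) (D * β) + frontCut α β e j r (D - e) := by
  have hj : (0 : ℝ) ≤ j := j.cast_nonneg
  rcases le_total (r * α) ((D - e + r) * β) with hc | hc
  · refine min_le_of_left_le ?_
    rw [frontCut, frontCut, fullCut_succ', sub_right_comm, ← add_assoc, ← add_assoc]
    refine add_le_add_left ?_ _
    have h0 : 0 ≤ r * β := mul_nonneg hr hβ
    have h1 : 0 ≤ (e - r) * β := mul_nonneg (by linarith) hβ
    have h2 : (D - e) * β = D * β - (e - r) * β - r * β := by ring
    have h3 : (D - r) * β = D * β - r * β := by ring
    have h4 : (D - e + r) * β = D * β - (e - r) * β := by ring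
    -- if `α ≤ β` then the part `r` is not limited by the helpers, even behind the full part;
    -- otherwise the change from `r` to `e` raises `r α` by at least `(e - r) β`
    rcases le_total α β with hab | hab
    · have h5 : r * α ≤ (D - e) * β := by
        calc r * α ≤ r * β := mul_le_mul_of_nonneg_left hab hr
          _ ≤ (D - e) * β := mul_le_mul_of_nonneg_right (by nlinarith) hβ
      rw [min_eq_left h5, add_comm]
      refine add_le_add (min_le_min le_rfl ?_) (min_le_left _ _)
      linarith
    · have h5 : (e - r) * β ≤ (e - r) * α := mul_le_mul_of_nonneg_left hab (by linarith)
      have h6 : e * α = r * α + (e - r) * α := by ring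
      have := min_le_left (r * α) (D * β)
      have := min_le_right (e * α) ((D - r) * β)
      have := min_le_left (e * α) ((D - r) * β)
      rcases min_choice (e * α) (D * β) with h7 | h7 <;>
      rcases min_choice (r * α) ((D - e) * β) with h8 | h8 <;>
      rw [h7, h8] <;> linarith
  · refine min_le_of_right_le ?_
    have : backCut α β e (j + 1) r D = min (e * α) (D * β) + backCut α β e j r (D - e) := by
      rw [backCut, backCut, fullCut_succ', add_assoc]
      push_cast
      congr 4
      ring
    rw [this]
    refine add_le_add_right (backCut_le_frontCut hβ hr hre (by linarith) ?_) _
    refine le_trans (mul_le_mul_of_nonneg_right ?_ hβ) hc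
    nlinarith [mul_nonneg hj (sub_nonneg.2 hre)]

end Comparison

/-! ### Reduction of an arbitrary scenario by concavity -/

theorem concaveOn_min_affine (p q p' q' : ℝ) :
    ConcaveOn ℝ Set.univ fun u : ℝ => min (p * u + q) (p' * u + q') := by
  have h : ∀ p q : ℝ, ConcaveOn ℝ Set.univ fun u : ℝ => p * u + q := by
    intro p q
    refine ⟨convex_univ, fun x _ y _ a b _ _ hab => le_of_eq ?_⟩
    simp only [smul_eq_mul]
    linear_combination q * hab
  exact (h p q).inf (h p' q')

theorem concaveOn_fullCut_sub (α β e D : ℝ) (j : ℕ) :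
    ConcaveOn ℝ Set.univ fun u : ℝ => fullCut α β e j (D - u) := by
  induction j with
  | zero => simpa [fullCut] using concaveOn_const (0 : ℝ) convex_univ
  | succ j ih =>
    have h := ih.add (concaveOn_min_affine 0 (e * α) (-β) ((D - j * e) * β))
    refine h.congr fun u _ => ?_
    simp only [Pi.add_apply, fullCut_succ]
    congr 2 <;> ring

section Reduction

variable {α β e u r D : ℝ} {j : ℕ}

theorem min_le_of_concaveOn {f : ℝ → ℝ} (hf : ConcaveOn ℝ Set.univ f) {x y z : ℝ}
    (hx : x ≤ z) (hy : z ≤ y) : min (f x) (f y) ≤ f z :=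
  hf.min_le_of_mem_Icc (Set.mem_univ _) (Set.mem_univ _) ⟨hx, hy⟩

/-- A part in front of `[e, …, e, r]` is merged with `r` as far as possible. -/
theorem min_le_part_then_back (hβ : 0 ≤ β) (hu : 0 ≤ u) (hue : u ≤ e) (hr : 0 ≤ r)
    (hre : r ≤ e) (hD : u + j * e + r ≤ D) :
    (u + r ≤ e → min (frontCut α β e j (u + r) D) (backCut α β e j (u + r) D) ≤
      min (u * α) (D * β) + backCut α β e j r (D - u)) ∧
    (e ≤ u + r → min (frontCut α β e (j + 1) (u + r - e) D)
        (backCut α β e (j + 1) (u + r - e) D) ≤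
      min (u * α) (D * β) + backCut α β e j r (D - u)) := by
  have hje : 0 ≤ j * e := mul_nonneg j.cast_nonneg (hr.trans hre)
  have hDβ : 0 ≤ D * β := mul_nonneg (by linarith) hβ
  have hconc : ConcaveOn ℝ Set.univ fun x : ℝ =>
      min (x * α) (D * β) + (fullCut α β e j (D - x) +
        min ((u + r - x) * α) ((D - x - j * e) * β)) := by
    refine ((concaveOn_min_affine α 0 0 (D * β)).add ((concaveOn_fullCut_sub α β e D j).add
      (concaveOn_min_affine (-α) ((u + r) * α) (-β) ((D - j * e) * β)))).congr fun x _ => ?_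
    simp only [Pi.add_apply]
    congr 1
    · congr 1 <;> ring
    · congr 2 <;> ring
  have hval : min (u * α) (D * β) + backCut α β e j r (D - u) = min (u * α) (D * β) +
      (fullCut α β e j (D - u) + min ((u + r - u) * α) ((D - u - j * e) * β)) := by
    rw [backCut, add_sub_cancel_left]
  rw [hval]
  refine ⟨fun _ => ?_, fun hs => ?_⟩
  · refine le_trans (le_of_eq ?_)
      (min_le_of_concaveOn hconc (x := 0) (y := u + r) hu (by linarith))
    have h1 : 0 ≤ (D - (u + r) - j * e) * β := mul_nonneg (by linarith) hβ
    rw [min_comm]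
    simp [frontCut, backCut, hDβ, h1]
  · refine le_trans (le_of_eq ?_)
      (min_le_of_concaveOn hconc (x := u + r - e) (y := e) (by linarith) hue)
    simp only [frontCut, backCut]
    rw [fullCut_succ, fullCut_succ', sub_sub_cancel, add_assoc (min (e * α) (D * β))]
    push_cast
    congr 5
    ring

/-- A part in front of `[r, e, …, e]` is merged with `r` as far as possible. -/
theorem min_le_part_then_front (hβ : 0 ≤ β) (hu : 0 ≤ u) (hue : u ≤ e) (hr : 0 ≤ r)
    (hre : r ≤ e) (hD : u + j * e + r ≤ D) :
    (u + r ≤ e → min (frontCut α β e j (u + r) D) (backCut α β e j (u + r) D) ≤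
      min (u * α) (D * β) + frontCut α β e j r (D - u)) ∧
    (e ≤ u + r → min (frontCut α β e (j + 1) (u + r - e) D)
        (backCut α β e (j + 1) (u + r - e) D) ≤
      min (u * α) (D * β) + frontCut α β e j r (D - u)) := by
  have hje : 0 ≤ j * e := mul_nonneg j.cast_nonneg (hr.trans hre)
  have hDβ : 0 ≤ D * β := mul_nonneg (by linarith) hβ
  have hconc : ConcaveOn ℝ Set.univ fun x : ℝ =>
      min (x * α) (D * β) + (min ((u + r - x) * α) ((D - x) * β) +
        fullCut α β e j (D - (u + r))) := by
    refine ((concaveOn_min_affine α 0 0 (D * β)).add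
      ((concaveOn_min_affine (-α) ((u + r) * α) (-β) (D * β)).add
        (concaveOn_const (fullCut α β e j (D - (u + r))) convex_univ))).congr fun x _ => ?_
    simp only [Pi.add_apply]
    congr 1
    · congr 1 <;> ring
    · congr 2 <;> ring
  have hval : min (u * α) (D * β) + frontCut α β e j r (D - u) = min (u * α) (D * β) +
      (min ((u + r - u) * α) ((D - u) * β) + fullCut α β e j (D - (u + r))) := by
    rw [frontCut, add_sub_cancel_left, sub_sub]
  rw [hval]
  refine ⟨fun _ => ?_, fun hs => ?_⟩
  · refine le_trans (min_le_of_left_le (le_of_eq ?_))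
      (min_le_of_concaveOn hconc (x := 0) (y := u + r) hu (by linarith))
    have h1 : 0 ≤ (D - (u + r)) * β := mul_nonneg (by linarith) hβ
    simp [frontCut, hDβ, h1]
  · refine le_trans (le_min ?_ ?_)
      (min_le_of_concaveOn hconc (x := u + r - e) (y := e) (by linarith) hue)
    · refine min_le_of_left_le (le_of_eq ?_)
      rw [frontCut, fullCut_succ', sub_sub_cancel, sub_sub, sub_add_cancel]
    · refine le_trans (min_le_full_then_front (j := j) hβ (by linarith) (by linarith)
        (by linarith)) (le_of_eq ?_)
      rw [frontCut]
      congr 3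
      ring

end Reduction

/-- Every scenario has at least the cut value of one of the two extreme scenarios: the part put in
front of a shorter scenario is merged with the remainder of the latter. -/
theorem min_frontCut_backCut_le_cutFrom {α β : ℝ} (hβ : 0 ≤ β) {e : ℕ} (he : 1 ≤ e)
    (us : List ℕ) (hus : ∀ x ∈ us, x ≤ e) (D : ℝ) (hD : (us.sum : ℝ) ≤ D) :
    min (frontCut α β e (us.sum / e) (us.sum % e : ℕ) D)
      (backCut α β e (us.sum / e) (us.sum % e : ℕ) D) ≤ cutFrom α β D us := by
  induction us generalizing D with
  | nil =>
    have hD : 0 ≤ D := by simpa using hD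
    simp [frontCut, backCut, fullCut, cutFrom, mul_nonneg hD hβ]
  | cons u us ih =>
    have hue : u ≤ e := hus u (by simp)
    have hD' : (u : ℝ) + us.sum ≤ D := by simpa using hD
    have h := ih (fun x hx => hus x (by simp [hx])) (D - u) (by linarith)
    rw [cutFrom]
    refine le_trans ?_ (add_le_add_right h _)
    have hmod : us.sum % e < e := Nat.mod_lt _ he
    have hdm := Nat.div_add_mod us.sum e
    set q := us.sum / e
    set r := us.sum % e
    have hsum : (u : ℝ) + q * e + r ≤ D := by
      have : (q : ℝ) * e + r = (us.sum : ℕ) := by rw [← hdm]; push_cast; ring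
      linarith
    have hback := min_le_part_then_back (α := α) (e := (e : ℝ)) (u := (u : ℝ)) (r := (r : ℝ)) hβ
      u.cast_nonneg (by exact_mod_cast hue) r.cast_nonneg (by exact_mod_cast hmod.le) hsum
    have hfront := min_le_part_then_front (α := α) (e := (e : ℝ)) (u := (u : ℝ)) (r := (r : ℝ)) hβ
      u.cast_nonneg (by exact_mod_cast hue) r.cast_nonneg (by exact_mod_cast hmod.le) hsum
    rw [add_min]
    rcases lt_or_ge (u + r) e with hs | hs
    · have h1 : (u :: us).sum = u + r + e * q := by rw [List.sum_cons]; omega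
      rw [h1, Nat.add_mul_div_left _ _ he, Nat.div_eq_of_lt hs, zero_add,
        Nat.add_mul_mod_self_left, Nat.mod_eq_of_lt hs]
      have hs' : (u : ℝ) + r ≤ e := by exact_mod_cast hs.le
      push_cast
      exact le_min (hfront.1 hs') (hback.1 hs')
    · have h1 : (u :: us).sum = (u + r - e) + e * (q + 1) := by
        rw [List.sum_cons, mul_add]; omega
      have hs2 : u + r - e < e := by omega
      rw [h1, Nat.add_mul_div_left _ _ he, Nat.div_eq_of_lt hs2, zero_add,
        Nat.add_mul_mod_self_left, Nat.mod_eq_of_lt hs2]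
      have hs' : (e : ℝ) ≤ u + r := by exact_mod_cast hs
      rw [Nat.cast_sub hs]
      push_cast
      exact le_min (hfront.2 hs') (hback.2 hs')

theorem cutFrom_optimalScenario {k d e : ℕ} {α β : ℝ} (hβ : 0 ≤ β) (he : 1 ≤ e)
    (hkd : k ≤ d) :
    cutFrom α β d (optimalScenario k d e α β) =
      min (frontCut α β e (k / e) (k % e : ℕ) d) (backCut α β e (k / e) (k % e : ℕ) d) := by
  have hmod : k % e < e := Nat.mod_lt _ he
  have hdm : (k / e : ℕ) * (e : ℝ) + (k % e : ℕ) ≤ d := by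
    have := Nat.div_add_mod' k e
    exact_mod_cast this.le.trans hkd
  have hd0 : (0 : ℝ) ≤ d * β := mul_nonneg d.cast_nonneg hβ
  have hfront : cutFrom α β d ((k % e) :: List.replicate (k / e) e) =
      frontCut α β e (k / e) (k % e : ℕ) d := by
    rw [cutFrom, cutFrom_replicate, frontCut]
  have hback : cutFrom α β d (List.replicate (k / e) e ++ [k % e]) =
      backCut α β e (k / e) (k % e : ℕ) d := by
    rw [cutFrom_append, cutFrom_replicate, backCut]
    simp [cutFrom]
  have hzero : k % e = 0 → frontCut α β e (k / e) (k % e : ℕ) d = fullCut α β e (k / e) d ∧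
      backCut α β e (k / e) (k % e : ℕ) d = fullCut α β e (k / e) d := by
    intro h
    have h1 : 0 ≤ ((d : ℝ) - (k / e : ℕ) * e) * β :=
      mul_nonneg (by rw [h] at hdm; push_cast at hdm ⊢; linarith) hβ
    rw [h]
    constructor
    · simp [frontCut, hd0]
    · rw [backCut]; simp [h1]
  unfold optimalScenario
  simp only
  split_ifs with h1 h2 h3
  · rcases h1.lt_or_eq with h | rfl
    · rw [Nat.div_eq_of_lt h, Nat.mod_eq_of_lt h]
      simp [cutFrom, frontCut, backCut, fullCut]
    · obtain ⟨h4, h5⟩ := hzero (Nat.mod_self k)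
      rw [h4, h5, min_self, Nat.div_self he, ← cutFrom_replicate]
      rfl
  · obtain ⟨h4, h5⟩ := hzero (by
      have := Nat.div_add_mod' k e
      omega)
    rw [h4, h5, min_self, cutFrom_replicate]
  · have hr : (0 : ℝ) < (k % e : ℕ) := by
      have := Nat.div_add_mod' k e
      exact_mod_cast (show 0 < k % e by omega)
    rw [hfront, min_eq_left]
    refine frontCut_le_backCut hβ hr.le (by exact_mod_cast hmod) hdm ?_
    rw [div_mul_eq_mul_div, le_div_iff₀ hr] at h3
    linarith
  · have hr : (0 : ℝ) < (k % e : ℕ) := by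
      have := Nat.div_add_mod' k e
      exact_mod_cast (show 0 < k % e by omega)
    rw [hback, min_eq_right]
    refine backCut_le_frontCut hβ hr.le (by exact_mod_cast hmod.le) hdm ?_
    rw [div_mul_eq_mul_div, not_le, div_lt_iff₀ hr] at h3
    linarith

theorem optimalScenario_mem {k d e : ℕ} (α β : ℝ) (he : 1 ≤ e) (hk : 1 ≤ k) :
    optimalScenario k d e α β ∈ scenarios k e := by
  have hmod : k % e < e := Nat.mod_lt _ he
  have hdm := Nat.div_add_mod' k e
  unfold optimalScenario
  simp only
  split_ifs with h1 h2 h3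
  · simp [scenarios, hk, h1]
  · refine ⟨fun x hx => ?_, by simp [← h2]⟩
    rw [List.eq_of_mem_replicate hx]
    exact ⟨he, le_rfl⟩
  · refine ⟨fun x hx => ?_, by simp; omega⟩
    rcases List.mem_cons.1 hx with rfl | hx
    · omega
    · rw [List.eq_of_mem_replicate hx]
      exact ⟨he, le_rfl⟩
  · refine ⟨fun x hx => ?_, by simp; omega⟩
    rcases List.mem_append.1 hx with hx | hx
    · rw [List.eq_of_mem_replicate hx]
      exact ⟨he, le_rfl⟩
    · rw [List.mem_singleton] at hx
      omega

theorem cutValue_optimalScenario_le {k d e : ℕ} {α β : ℝ} (hβ : 0 ≤ β) (he : 1 ≤ e)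
    (hkd : k ≤ d) {u : List ℕ} (hu : u ∈ scenarios k e) :
    cutValue d α β (optimalScenario k d e α β) ≤ cutValue d α β u := by
  rw [cutValue_eq_cutFrom, cutValue_eq_cutFrom, cutFrom_optimalScenario hβ he hkd]
  have h := min_frontCut_backCut_le_cutFrom (α := α) hβ he u (fun x hx => (hu.1 x hx).2) d
    (by rw [hu.2]; exact_mod_cast hkd)
  rwa [hu.2] at h

theorem length_optimalScenario {k d e : ℕ} (α β : ℝ) (he : 1 ≤ e) (hk : 1 ≤ k) :
    (optimalScenario k d e α β).length = ⌈(k : ℝ) / (e : ℝ)⌉₊ := by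
  have hmod : k % e < e := Nat.mod_lt _ he
  have hdm := Nat.div_add_mod' k e
  have he0 : (0 : ℝ) < e := by exact_mod_cast he
  have key : ∀ m : ℕ, k ≤ (m + 1) * e → m * e < k → m + 1 = ⌈(k : ℝ) / (e : ℝ)⌉₊ := by
    intro m h1 h2
    symm
    rw [Nat.ceil_eq_iff (Nat.succ_ne_zero m), Nat.succ_sub_one, lt_div_iff₀ he0,
      div_le_iff₀ he0]
    exact ⟨by exact_mod_cast h2, by exact_mod_cast h1⟩
  unfold optimalScenario
  simp only
  split_ifs with h1 h2 h3
  · simpa using key 0 (by simpa using h1) (by omega)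
  · obtain ⟨m, hm⟩ : ∃ m, k / e = m + 1 := Nat.exists_eq_succ_of_ne_zero (by
      rintro h; rw [h] at h2; omega)
    rw [hm] at h2
    rw [List.length_replicate, hm]
    exact key m h2.le (by rw [add_mul] at h2; omega)
  · rw [List.length_cons, List.length_replicate]
    exact key _ (by rw [add_mul]; omega) (by omega)
  · rw [List.length_append, List.length_replicate, List.length_singleton]
    exact key _ (by rw [add_mul]; omega) (by omega)

/-! ### The cut-set bound -/

theorem ncard_range_le_of_determined {W R P Q : Type*} [Finite W] [Fintype Q] (h : W → R)
    (p : W → P) (q : W → Q) (hdet : ∀ w w', p w = p w' → q w = q w' → h w = h w') :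
    (Set.range h).ncard ≤ (Set.range p).ncard * Fintype.card Q := by
  rcases isEmpty_or_nonempty W with hW | ⟨⟨w₀⟩⟩
  · rw [Set.range_eq_empty]; simp
  have : Nonempty R := ⟨h w₀⟩
  obtain ⟨g, hg⟩ := (Function.factorsThrough_iff (f := fun w => (p w, q w)) h).1 (by
    intro w w' hw
    rw [Prod.mk.injEq] at hw
    exact hdet w w' hw.1 hw.2)
  have hsub : Set.range h ⊆ g '' (Set.range p ×ˢ (Set.univ : Set Q)) := by
    rintro _ ⟨w, rfl⟩
    exact ⟨(p w, q w), ⟨⟨w, rfl⟩, trivial⟩, by rw [hg]; rfl⟩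
  have hfin : (Set.range p ×ˢ (Set.univ : Set Q)).Finite :=
    (Set.finite_range p).prod Set.finite_univ
  refine (Set.ncard_le_ncard hsub (hfin.image _)).trans ((Set.ncard_image_le hfin).trans ?_)
  rw [Set.ncard_prod, Set.ncard_univ, Nat.card_eq_fintype_card]

section Codes

variable {n : ℕ} {W X S : Type}

theorem Sustains.reconstructs {k d e T : ℕ} {c : Fin n → W → X} (h : Sustains k d e S T c) :
    Reconstructs k c := by
  cases T with
  | zero => exact h
  | succ T => exact h.1

/-- The contents of `D` and `U ⊆ E` after a repair of `E` are determined by those of `D` before it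
and the new contents of `U`. -/
theorem ncard_range_repair_le_storage [Finite W] [Fintype X] {E H D U : Finset (Fin n)}
    {c c' : Fin n → W → X} (h : IsRepair S E H c c') (hDE : Disjoint D E) :
    (Set.range fun w (i : (D ∪ U : Finset (Fin n))) => c' i w).ncard ≤
      (Set.range fun w (i : D) => c i w).ncard * Fintype.card X ^ U.card := by
  have h1 := ncard_range_le_of_determined
    (fun w (i : (D ∪ U : Finset (Fin n))) => c' i w) (fun w (i : D) => c i w)
    (fun w (i : U) => c' i w) (by
      intro w w' hp hq
      funext ⟨i, hi⟩
      rcases Finset.mem_union.1 hi with hD | hU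
      · have hiE : i ∉ E := Finset.disjoint_left.1 hDE hD
        simpa [h.1 i hiE] using congrFun hp ⟨i, hD⟩
      · exact congrFun hq ⟨i, hU⟩)
  simpa using h1

/-- The contents of `D` and `U ⊆ E` after a repair of `E` are determined by those of `D` before it
and the messages of the helpers outside `D`. -/
theorem ncard_range_repair_le_bandwidth [Finite W] [Fintype S] {E H D U : Finset (Fin n)}
    {c c' : Fin n → W → X} (h : IsRepair S E H c c') (hDE : Disjoint D E) (hU : U ⊆ E)
    (hDH : D ⊆ H) :
    (Set.range fun w (i : (D ∪ U : Finset (Fin n))) => c' i w).ncard ≤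
      (Set.range fun w (i : D) => c i w).ncard * Fintype.card S ^ (H.card - D.card) := by
  obtain ⟨hfix, send, regenerate, hreg⟩ := h
  have h1 := ncard_range_le_of_determined
    (fun w (i : (D ∪ U : Finset (Fin n))) => c' i w) (fun w (i : D) => c i w)
    (fun w (j : (H \ D : Finset (Fin n))) =>
      send ⟨j, (Finset.mem_sdiff.1 j.2).1⟩ (c j w)) (by
      intro w w' hp hq
      funext ⟨i, hi⟩
      rcases Finset.mem_union.1 hi with hD | hiU
      · have hiE : i ∉ E := Finset.disjoint_left.1 hDE hD
        simpa [hfix i hiE] using congrFun hp ⟨i, hD⟩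
      · have hw := hreg ⟨i, hU hiU⟩
        change c' i w = c' i w'
        refine (hw w).trans (Eq.trans ?_ (hw w').symm)
        congr 1
        funext ⟨j, hj⟩
        by_cases hjD : j ∈ D
        · exact congrArg _ (congrFun hp ⟨j, hjD⟩)
        · exact congrFun hq ⟨j, Finset.mem_sdiff.2 ⟨hj, hjD⟩⟩)
  rwa [Fintype.card_fun, Fintype.card_coe, Finset.card_sdiff_of_subset hDH] at h1

/-- Cut-set bound: `D` is a set of nodes whose contents are retained in all later rounds. In each
round the next part of the scenario is the number of nodes of `E` that join `D`, and all nodes of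
`D` are among the helpers. -/
theorem card_le_ncard_mul_rpow_cutFrom [Finite W] [Fintype X] [Fintype S] {k d e : ℕ}
    (hkd : k ≤ d) (hdn : d + e ≤ n) {b α β : ℝ} (hb : 1 < b)
    (hX : (Fintype.card X : ℝ) ≤ b ^ α) (hS : (Fintype.card S : ℝ) ≤ b ^ β)
    (us : List ℕ) (hus : ∀ x ∈ us, x ≤ e) (T : ℕ) (hT : us.length ≤ T)
    (c : Fin n → W → X) (hc : Sustains k d e S T c) (D : Finset (Fin n))
    (hD : D.card + us.sum = k) :
    (Nat.card W : ℝ) ≤ (Set.range fun w (i : D) => c i w).ncard *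
      b ^ cutFrom α β ((d : ℝ) - D.card) us := by
  have hb0 : 0 < b := zero_lt_one.trans hb
  induction us generalizing T c D with
  | nil =>
    obtain ⟨decode, hdec⟩ := hc.reconstructs D (by simpa using hD)
    have hinj : Function.Injective fun w (i : D) => c i w :=
      Function.LeftInverse.injective hdec
    rw [← Set.image_univ, Set.ncard_image_of_injective _ hinj, Set.ncard_univ]
    simp [cutFrom]
  | cons u us ih =>
    obtain ⟨T, rfl⟩ : ∃ T', T = T' + 1 := Nat.exists_eq_succ_of_ne_zero (by
      rintro rfl; simp at hT)
    rw [List.sum_cons] at hD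
    have hue : u ≤ e := hus u (by simp)
    obtain ⟨E, hED, hE⟩ := Finset.exists_subset_card_eq (s := Dᶜ) (n := e) (by
      rw [Finset.card_compl, Fintype.card_fin]; omega)
    have hDE : Disjoint D E := Finset.disjoint_left.2 fun i hi hiE =>
      Finset.mem_compl.1 (hED hiE) hi
    obtain ⟨H, hDH, hHE, hH⟩ := Finset.exists_subsuperset_card_eq (s := D) (t := Eᶜ) (n := d)
      (fun i hi => Finset.mem_compl.2 (Finset.disjoint_left.1 hDE hi)) (by omega) (by
        rw [Finset.card_compl, Fintype.card_fin]; omega)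
    obtain ⟨U, hU, hUcard⟩ := Finset.exists_subset_card_eq (s := E) (n := u) (by omega)
    obtain ⟨c', hrep, hc'⟩ := hc.2 E H hE hH (Finset.disjoint_left.2 fun i hi hiH =>
      Finset.mem_compl.1 (hHE hiH) hi)
    have hcard : (D ∪ U).card = D.card + u := by
      rw [Finset.card_union_of_disjoint (hDE.mono_right hU), hUcard]
    have hrec := ih (fun x hx => hus x (by simp [hx])) T (by simpa using hT) c' hc' (D ∪ U)
      (by omega)
    refine hrec.trans ?_
    rw [cutFrom, Real.rpow_add hb0, ← mul_assoc, hcard, Nat.cast_add, sub_add_eq_sub_sub]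
    refine mul_le_mul_of_nonneg_right ?_ (Real.rpow_nonneg hb0.le _)
    have hpow : ∀ (N m : ℕ) (γ : ℝ), (N : ℝ) ≤ b ^ γ → ((N ^ m : ℕ) : ℝ) ≤ b ^ (m * γ) := by
      intro N m γ h
      rw [mul_comm, Real.rpow_mul hb0.le, Real.rpow_natCast, Nat.cast_pow]
      exact pow_le_pow_left₀ N.cast_nonneg h m
    rcases min_choice ((u : ℝ) * α) (((d : ℝ) - D.card) * β) with hm | hm <;> rw [hm]
    · refine le_trans (Nat.cast_le.2 (ncard_range_repair_le_storage (U := U) hrep hDE)) ?_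
      rw [Nat.cast_mul, hUcard]
      exact mul_le_mul_of_nonneg_left (hpow _ _ _ hX) (Nat.cast_nonneg _)
    · refine le_trans (Nat.cast_le.2 (ncard_range_repair_le_bandwidth hrep hDE hU hDH)) ?_
      rw [Nat.cast_mul, hH, ← Nat.cast_sub (by omega : D.card ≤ d)]
      exact mul_le_mul_of_nonneg_left (hpow _ _ _ hS) (Nat.cast_nonneg _)

end Codes

theorem ExactCodeExists.le_cutValue {M α β : ℝ} {n k d e T : ℕ} (hkd : k ≤ d)
    (hdn : d + e ≤ n) {u : List ℕ} (hu : u ∈ scenarios k e) (hT : u.length ≤ T)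
    (h : ExactCodeExists M n k d e α β T) : M ≤ cutValue d α β u := by
  obtain ⟨b, hb, w, x, s, hw, hx, hs, c, hc⟩ := h
  have h1 := card_le_ncard_mul_rpow_cutFrom (W := Fin w) (X := Fin x) (S := Fin s) hkd hdn
    (α := α) (β := β) hb (by simpa using hx) (by simpa using hs) u (fun x hx => (hu.1 x hx).2) T
    hT c hc ∅ (by simpa using hu.2)
  have h2 : (Set.range fun (w : Fin w) (i : (∅ : Finset (Fin n))) => c i w).ncard ≤ 1 :=
    Set.ncard_le_one_of_subsingleton _
  have hb0 : 0 < b := zero_lt_one.trans hb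
  have h3 : b ^ M ≤ b ^ cutFrom α β d u := by
    refine hw.trans ?_
    simp only [Nat.card_eq_fintype_card, Fintype.card_fin, Finset.card_empty, Nat.cast_zero,
      sub_zero] at h1
    refine h1.trans (mul_le_of_le_one_left (Real.rpow_nonneg hb0.le _) (by exact_mod_cast h2))
  rw [cutValue_eq_cutFrom]
  exact (Real.rpow_le_rpow_left_iff hb).1 h3

/-! ### Generic vectors over a large finite field -/

section Generic

variable {F V : Type*} [Field F] [AddCommGroup V] [Module F V]

open scoped Pointwise in
/-- A subspace `P` is not covered by fewer than `|F|` subspaces that do not contain it, by Neumann's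
lemma on coverings by cosets: the index of a proper subspace of `P` is at least `|F|`. -/
theorem exists_mem_forall_notMem (P : Submodule F V) (s : Finset (Submodule F V))
    (hs : ∀ W ∈ s, ¬ P ≤ W) (hcard : s.card < Nat.card F) : ∃ x ∈ P, ∀ W ∈ s, x ∉ W := by
  by_contra! h
  have hcov : ⋃ W ∈ s, (0 : P) +ᵥ ((W.comap P.subtype).toAddSubgroup : Set P) = Set.univ := by
    refine Set.eq_univ_of_forall fun x => ?_
    obtain ⟨W, hW, hx⟩ := h x x.2
    simp only [zero_vadd, Set.mem_iUnion]
    exact ⟨W, hW, hx⟩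
  obtain ⟨W, hW, hfin, hind⟩ := AddSubgroup.exists_index_le_card_of_leftCoset_cover hcov
  have hne : W.comap P.subtype ≠ ⊤ := fun htop => hs W hW fun x hx => by
    have : (⟨x, hx⟩ : P) ∈ W.comap P.subtype := htop ▸ Submodule.mem_top
    exact this
  have : Nontrivial (P ⧸ W.comap P.subtype) := Submodule.Quotient.nontrivial_iff.2 hne
  have : Finite (P ⧸ W.comap P.subtype) := AddSubgroup.finite_quotient_of_finiteIndex
    (H := (W.comap P.subtype).toAddSubgroup)
  obtain ⟨x, hx⟩ := exists_ne (0 : P ⧸ W.comap P.subtype)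
  have hle : Nat.card F ≤ Nat.card (P ⧸ W.comap P.subtype) :=
    Nat.card_le_card_of_injective (fun a : F => a • x) (smul_left_injective F hx)
  exact absurd (hle.trans hind) (not_le.2 hcard)

variable [FiniteDimensional F V]

/-- Generic vectors `x t ∈ P t` satisfy Rado's rank formula, also modulo the subspaces of a given
finite family, of which the lower bound is stated. -/
theorem exists_generic_vectors {ι : Type*} [DecidableEq ι] (P : ι → Submodule F V)
    (S : Finset ι) (𝒴 : Finset (Submodule F V)) (hcard : 𝒴.card * 2 ^ S.card < Nat.card F) :
    ∃ x : ι → V, (∀ t, x t ∈ P t) ∧ ∀ Y ∈ 𝒴, ∀ T ⊆ S, ∃ B ⊆ T,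
      Module.finrank F (Y ⊔ ⨆ t ∈ B, P t : Submodule F V) + (T \ B).card ≤
        Module.finrank F (Y ⊔ Submodule.span F (x '' T) : Submodule F V) := by
  classical
  induction S using Finset.induction_on generalizing 𝒴 with
  | empty =>
    refine ⟨0, fun t => zero_mem _, fun Y _ T hT => ⟨∅, Finset.empty_subset _, ?_⟩⟩
    rw [Finset.subset_empty.1 hT, Finset.sdiff_self, Finset.card_empty, add_zero]
    exact Submodule.finrank_mono (by simp)
  | insert t S ht ih =>
    rw [Finset.card_insert_of_notMem ht, pow_succ] at hcard
    obtain ⟨z, hzP, hz⟩ := exists_mem_forall_notMem (P t)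
      (((𝒴 ×ˢ S.powerset).image fun p => p.1 ⊔ ⨆ i ∈ p.2, P i).filter fun W => ¬ P t ≤ W)
      (fun W hW => (Finset.mem_filter.1 hW).2) (by
        refine lt_of_le_of_lt ((Finset.card_filter_le _ _).trans Finset.card_image_le) ?_
        rw [Finset.card_product, Finset.card_powerset]
        refine lt_of_le_of_lt ?_ hcard
        exact Nat.mul_le_mul_left _ (by omega))
    obtain ⟨x, hxP, hx⟩ := ih (𝒴 ∪ 𝒴.image fun Y => Y ⊔ Submodule.span F {z}) (by
      refine lt_of_le_of_lt (Nat.mul_le_mul_right _ ((Finset.card_union_le _ _).trans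
        (Nat.add_le_add_left Finset.card_image_le _))) (lt_of_le_of_lt (le_of_eq ?_) hcard)
      ring)
    refine ⟨Function.update x t z, fun i => ?_, fun Y hY T hT => ?_⟩
    · rcases eq_or_ne i t with rfl | hi
      · simpa using hzP
      · simpa [hi] using hxP i
    by_cases htT : t ∈ T
    · have hT' : T.erase t ⊆ S := fun i hi => by
        have := hT (Finset.mem_of_mem_erase hi)
        exact (Finset.mem_insert.1 this).resolve_left (Finset.ne_of_mem_erase hi)
      obtain ⟨B, hB, hrank⟩ := hx (Y ⊔ Submodule.span F {z})
        (Finset.mem_union_right _ (Finset.mem_image_of_mem _ hY)) (T.erase t) hT'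
      have htB : t ∉ B := fun h => Finset.notMem_erase t T (hB h)
      have hspan : Submodule.span F (Function.update x t z '' T) =
          Submodule.span F {z} ⊔ Submodule.span F (x '' (T.erase t : Finset ι)) := by
        rw [← Submodule.span_union]
        congr 1
        conv_lhs => rw [← Finset.insert_erase htT]
        rw [Finset.coe_insert, Set.image_insert_eq, Function.update_self, Set.singleton_union]
        congr 1
        refine Set.image_congr fun i hi => ?_
        have : i ≠ t := Finset.ne_of_mem_erase (Finset.mem_coe.1 hi)
        simp [this]
      rw [hspan, ← sup_assoc]
      by_cases hle : P t ≤ Y ⊔ ⨆ i ∈ B, P i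
      · refine ⟨insert t B, Finset.insert_subset htT (hB.trans (Finset.erase_subset _ _)), ?_⟩
        refine le_trans (add_le_add (Submodule.finrank_mono ?_) (le_of_eq ?_)) hrank
        · rw [Finset.iSup_insert, sup_left_comm]
          refine sup_le ?_ (sup_le_sup_right le_sup_left _)
          exact hle.trans (sup_le_sup_right le_sup_left _)
        · rw [Finset.sdiff_insert, Finset.erase_sdiff_comm]
      · refine ⟨B, hB.trans (Finset.erase_subset _ _), le_trans ?_ hrank⟩
        have hzn : z ∉ Y ⊔ ⨆ i ∈ B, P i := hz _ (Finset.mem_filter.2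
          ⟨Finset.mem_image.2 ⟨(Y, B), Finset.mem_product.2
            ⟨hY, Finset.mem_powerset.2 (hB.trans hT')⟩, rfl⟩, hle⟩)
        have hlt : Module.finrank F (Y ⊔ ⨆ i ∈ B, P i : Submodule F V) <
            Module.finrank F (Y ⊔ Submodule.span F {z} ⊔ ⨆ i ∈ B, P i : Submodule F V) := by
          refine Submodule.finrank_lt_finrank_of_lt (lt_of_le_of_ne
            (sup_le_sup_right le_sup_left _) fun heq => hzn ?_)
          rw [heq]
          exact Submodule.mem_sup_left (Submodule.mem_sup_right
            (Submodule.mem_span_singleton_self z))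
        have hc : (T \ B).card = (T.erase t \ B).card + 1 := by
          rw [Finset.erase_sdiff_comm, Finset.card_erase_add_one
            (Finset.mem_sdiff.2 ⟨htT, htB⟩)]
        omega
    · have hT' : T ⊆ S := fun i hi => (Finset.mem_insert.1 (hT hi)).resolve_left
        (by rintro rfl; exact htT hi)
      obtain ⟨B, hB, hrank⟩ := hx Y (Finset.mem_union_left _ hY) T hT'
      refine ⟨B, hB, ?_⟩
      have : Function.update x t z '' T = x '' T := Set.image_congr fun i hi => by
        have : i ≠ t := by rintro rfl; exact htT hi
        simp [this]
      rwa [this]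

end Generic

/-! ### Repair of linear codes -/

/-- A lower bound `Γ` for the rank of the joint content of a set of nodes, as a function of the
number of nodes, that repairs can preserve: `e` nodes of `a` symbols are repaired with `b` symbols
from each of `d` helpers. For `y ≥ d` the truncated subtraction makes `Γ` constant. -/
structure IsRankProfile (Γ : ℕ → ℕ) (d e a b : ℕ) : Prop where
  mono : Monotone Γ
  storage : ∀ y u, u ≤ e → Γ (y + u) ≤ Γ y + u * a
  bandwidth : ∀ y u, u ≤ e → Γ (y + u) ≤ Γ y + (d - y) * b

section Linear

variable {F V : Type*} [Field F] [AddCommGroup V] [Module F V] {n a b : ℕ}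

/-- The span of the joint content of the nodes in `A`, where node `i` stores the values of the
vectors (linear forms) `v (i, l)`. -/
def nodeSpan (F : Type*) {V : Type*} [Field F] [AddCommGroup V] [Module F V] {n a : ℕ}
    (v : Fin n × Fin a → V) (A : Finset (Fin n)) : Submodule F V :=
  Submodule.span F (v '' (A ×ˢ Finset.univ : Finset (Fin n × Fin a)))

theorem mem_nodeSpan {v : Fin n × Fin a → V} {A : Finset (Fin n)} {i : Fin n} (hi : i ∈ A)
    (l : Fin a) : v (i, l) ∈ nodeSpan F v A :=
  Submodule.subset_span ⟨(i, l), by simpa using hi, rfl⟩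

theorem nodeSpan_le {v : Fin n × Fin a → V} {A : Finset (Fin n)} {W : Submodule F V}
    (h : ∀ i ∈ A, ∀ l, v (i, l) ∈ W) : nodeSpan F v A ≤ W := by
  refine Submodule.span_le.2 ?_
  rintro _ ⟨⟨i, l⟩, hi, rfl⟩
  exact h i (by simpa using hi) l

theorem card_image_nodeSpan_le [DecidableEq (Submodule F V)] (v : Fin n × Fin a → V) :
    (Finset.univ.image (nodeSpan F v)).card ≤ 2 ^ n := by
  refine Finset.card_image_le.trans ?_
  simp

variable [FiniteDimensional F V]

/-- With generic messages, the central node receives enough that a rank profile could be kept if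
all that it received were stored. -/
theorem exists_messages {Γ : ℕ → ℕ} {d e : ℕ} (hΓ : IsRankProfile Γ d e a b)
    (hb : 2 ^ n * 2 ^ (n * b) < Nat.card F)
    (v : Fin n × Fin a → V) (hv : ∀ A, Γ A.card ≤ Module.finrank F (nodeSpan F v A))
    (H : Finset (Fin n)) (hH : H.card = d) :
    ∃ s : Fin n × Fin b → V, (∀ j l, s (j, l) ∈ nodeSpan F v {j}) ∧
      ∀ Y : Finset (Fin n), ∀ u ≤ e,
        Γ (Y.card + u) ≤ Module.finrank F (nodeSpan F v Y ⊔ nodeSpan F s H : Submodule F V) := by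
  classical
  obtain ⟨s, hsP, hs⟩ := exists_generic_vectors (fun t : Fin n × Fin b => nodeSpan F v {t.1})
    Finset.univ (Finset.univ.image (nodeSpan F v)) (by
      rw [Finset.card_univ, Fintype.card_prod, Fintype.card_fin, Fintype.card_fin]
      exact lt_of_le_of_lt (Nat.mul_le_mul_right _ (card_image_nodeSpan_le v)) hb)
  refine ⟨s, fun j l => hsP (j, l), fun Y u hu => ?_⟩
  obtain ⟨C, hC, hrank⟩ := hs (nodeSpan F v Y)
    (Finset.mem_image_of_mem _ (Finset.mem_univ _)) (H ×ˢ Finset.univ) (Finset.subset_univ _)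
  refine le_trans ?_ hrank
  -- `G` consists of the helpers whose whole content is accounted for in the rank formula
  obtain ⟨G, hG⟩ : ∃ G, G = C.image Prod.fst := ⟨_, rfl⟩
  have hspan : nodeSpan F v (Y ∪ G) ≤ nodeSpan F v Y ⊔ ⨆ t ∈ C, nodeSpan F v {t.1} := by
    refine nodeSpan_le fun i hi l => ?_
    rcases Finset.mem_union.1 hi with hi | hi
    · exact Submodule.mem_sup_left (mem_nodeSpan hi l)
    · obtain ⟨t, htC, rfl⟩ := Finset.mem_image.1 (hG ▸ hi)
      refine Submodule.mem_sup_right ?_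
      exact (le_iSup₂_of_le (f := fun (t : Fin n × Fin b) (_ : t ∈ C) => nodeSpan F v {t.1})
        t htC le_rfl) (mem_nodeSpan (Finset.mem_singleton_self _) l)
  have hcount : (d - (Y ∪ G).card) * b ≤ ((H ×ˢ Finset.univ) \ C).card := by
    have h1 : (H \ (Y ∪ G)) ×ˢ (Finset.univ : Finset (Fin b)) ⊆ (H ×ˢ Finset.univ) \ C := by
      rintro ⟨j, l⟩ hj
      rw [Finset.mem_product, Finset.mem_sdiff] at hj
      refine Finset.mem_sdiff.2 ⟨Finset.mem_product.2 ⟨hj.1.1, hj.2⟩, fun hC => hj.1.2 ?_⟩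
      exact Finset.mem_union_right _ (hG ▸ Finset.mem_image.2 ⟨(j, l), hC, rfl⟩)
    refine le_trans ?_ (Finset.card_le_card h1)
    rw [Finset.card_product, Finset.card_univ, Fintype.card_fin]
    refine Nat.mul_le_mul_right _ ?_
    rw [← hH]
    exact Finset.le_card_sdiff _ _
  calc Γ (Y.card + u) ≤ Γ ((Y ∪ G).card + u) :=
        hΓ.mono (Nat.add_le_add_right (Finset.card_le_card Finset.subset_union_left) _)
    _ ≤ Γ (Y ∪ G).card + (d - (Y ∪ G).card) * b := hΓ.bandwidth _ _ hu
    _ ≤ _ := add_le_add ((hv _).trans (Submodule.finrank_mono hspan)) hcount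

/-- A centralized repair with generic messages and generic new contents preserves a rank
profile. -/
theorem exists_repair_vectors {Γ : ℕ → ℕ} {d e : ℕ} (hΓ : IsRankProfile Γ d e a b)
    (ha : 2 ^ n * 2 ^ (n * a) < Nat.card F) (hb : 2 ^ n * 2 ^ (n * b) < Nat.card F)
    (v : Fin n × Fin a → V) (hv : ∀ A, Γ A.card ≤ Module.finrank F (nodeSpan F v A))
    (E H : Finset (Fin n)) (hE : E.card = e) (hH : H.card = d) :
    ∃ (s : Fin n × Fin b → V) (v' : Fin n × Fin a → V),
      (∀ j l, s (j, l) ∈ nodeSpan F v {j}) ∧ (∀ i ∉ E, ∀ l, v' (i, l) = v (i, l)) ∧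
      (∀ i ∈ E, ∀ l, v' (i, l) ∈ nodeSpan F s H) ∧
      ∀ A, Γ A.card ≤ Module.finrank F (nodeSpan F v' A) := by
  classical
  obtain ⟨s, hsP, hs⟩ := exists_messages hΓ hb v hv H hH
  obtain ⟨x, hxP, hx⟩ := exists_generic_vectors (fun _ : Fin n × Fin a => nodeSpan F s H)
    Finset.univ (Finset.univ.image (nodeSpan F v)) (by
      rw [Finset.card_univ, Fintype.card_prod, Fintype.card_fin, Fintype.card_fin]
      exact lt_of_le_of_lt (Nat.mul_le_mul_right _ (card_image_nodeSpan_le v)) ha)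
  obtain ⟨v', hnew, hfix⟩ : ∃ v' : Fin n × Fin a → V,
      (∀ i ∈ E, ∀ l, v' (i, l) = x (i, l)) ∧ ∀ i ∉ E, ∀ l, v' (i, l) = v (i, l) :=
    ⟨fun t => if t.1 ∈ E then x t else v t, fun i hi l => if_pos hi, fun i hi l => if_neg hi⟩
  refine ⟨s, v', hsP, hfix, fun i hi l => hnew i hi l ▸ hxP (i, l), fun A => ?_⟩
  have hold : nodeSpan F v (A \ E) ⊔ nodeSpan F x (A ∩ E) ≤ nodeSpan F v' A := by
    refine sup_le (nodeSpan_le fun i hi l => ?_) (nodeSpan_le fun i hi l => ?_)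
    · obtain ⟨hiA, hiE⟩ := Finset.mem_sdiff.1 hi
      exact hfix i hiE l ▸ mem_nodeSpan hiA l
    · obtain ⟨hiA, hiE⟩ := Finset.mem_inter.1 hi
      exact hnew i hiE l ▸ mem_nodeSpan hiA l
  refine le_trans ?_ (Submodule.finrank_mono hold)
  have hue : (A ∩ E).card ≤ e := hE ▸ Finset.card_le_card Finset.inter_subset_right
  obtain ⟨B, -, hB⟩ := hx (nodeSpan F v (A \ E)) (Finset.mem_image_of_mem _ (Finset.mem_univ _))
    ((A ∩ E) ×ˢ Finset.univ) (Finset.subset_univ _)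
  refine le_trans ?_ hB
  rw [← Finset.card_sdiff_add_card_inter A E]
  rcases B.eq_empty_or_nonempty with rfl | ⟨t, ht⟩
  · rw [Finset.sdiff_empty, Finset.card_product, Finset.card_univ, Fintype.card_fin]
    refine (hΓ.storage _ _ hue).trans (Nat.add_le_add_right ((hv _).trans ?_) _)
    exact Submodule.finrank_mono le_sup_left
  · refine le_add_of_le_left ((hs _ _ hue).trans (Submodule.finrank_mono ?_))
    exact sup_le_sup_left (le_iSup₂_of_le (f := fun (t : Fin n × Fin a) (_ : t ∈ B) =>
      nodeSpan F s H) t ht le_rfl) _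

/-- The initial code: generic contents realize every rank profile bounded by the dimension. -/
theorem exists_vectors_of_rankProfile {Γ : ℕ → ℕ} {d e : ℕ} (hΓ : IsRankProfile Γ d e a b)
    (he : 1 ≤ e) (hΓ0 : Γ 0 = 0) (hm : ∀ y, Γ y ≤ Module.finrank F V)
    (ha : 2 ^ n * 2 ^ (n * a) < Nat.card F) :
    ∃ v : Fin n × Fin a → V, ∀ A, Γ A.card ≤ Module.finrank F (nodeSpan F v A) := by
  classical
  have hlin : ∀ y, Γ y ≤ y * a := by
    intro y
    induction y with
    | zero => simp [hΓ0]
    | succ y ih =>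
      have := hΓ.storage y 1 he
      rw [add_mul]
      omega
  obtain ⟨x, -, hx⟩ := exists_generic_vectors (fun _ : Fin n × Fin a => (⊤ : Submodule F V))
    Finset.univ {⊥} (by
      refine lt_of_le_of_lt ?_ ha
      simpa using Nat.one_le_two_pow)
  refine ⟨x, fun A => ?_⟩
  obtain ⟨B, -, hB⟩ := hx ⊥ (Finset.mem_singleton_self _) (A ×ˢ Finset.univ)
    (Finset.subset_univ _)
  rw [bot_sup_eq, bot_sup_eq] at hB
  refine le_trans ?_ hB
  rcases B.eq_empty_or_nonempty with rfl | ⟨t, ht⟩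
  · rw [Finset.sdiff_empty, Finset.card_product, Finset.card_univ, Fintype.card_fin]
    exact le_add_of_le_right (hlin _)
  · have htop : (⨆ t ∈ B, (⊤ : Submodule F V)) = ⊤ :=
      top_le_iff.1 (le_iSup₂_of_le t ht le_rfl)
    rw [htop, finrank_top]
    exact le_add_of_le_left (hm _)

end Linear

/-! ### Linear codes sustain repairs -/

/-- It suffices that the messages are determined by the contents of the helpers, and the new contents
by the messages. -/
theorem isRepair_of_determined {n : ℕ} {W X S : Type} [Nonempty X] [Nonempty S]
    {E H : Finset (Fin n)} {c c' : Fin n → W → X} (hfix : ∀ i ∉ E, c' i = c i)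
    (msg : Fin n → W → S) (hmsg : ∀ j ∈ H, ∀ w w', c j w = c j w' → msg j w = msg j w')
    (hreg : ∀ i ∈ E, ∀ w w', (∀ j ∈ H, msg j w = msg j w') → c' i w = c' i w') :
    IsRepair S E H c c' := by
  have h1 : ∀ j : H, ∃ send : X → S, msg j = send ∘ c j := fun j =>
    (Function.factorsThrough_iff _).1 fun w w' h => hmsg j j.2 w w' h
  choose send hsend using h1
  have h2 : ∀ i : E, ∃ g : (H → S) → X, c' i = g ∘ fun w (j : H) => msg j w := fun i =>
    (Function.factorsThrough_iff _).1 fun w w' h =>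
      hreg i i.2 w w' fun j hj => congrFun h ⟨j, hj⟩
  choose g hg using h2
  refine ⟨hfix, send, fun y i => g i y, fun i w => ?_⟩
  rw [hg i]
  refine congrArg (g i) (funext fun j => ?_)
  exact congrFun (hsend j) w

theorem dotProduct_eq_of_mem_nodeSpan {F : Type*} [Field F] {m n a : ℕ}
    {v : Fin n × Fin a → Fin m → F} {A : Finset (Fin n)} {x w w' : Fin m → F}
    (hx : x ∈ nodeSpan F v A)
    (h : ∀ i ∈ A, (fun l => v (i, l) ⬝ᵥ w) = fun l => v (i, l) ⬝ᵥ w') :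
    x ⬝ᵥ w = x ⬝ᵥ w' := by
  induction hx using Submodule.span_induction with
  | mem x hx =>
    obtain ⟨⟨i, l⟩, hi, rfl⟩ := hx
    exact congrFun (h i (by simpa using hi)) l
  | zero => simp
  | add x y _ _ hx hy => rw [add_dotProduct, add_dotProduct, hx, hy]
  | smul c x _ hx => rw [smul_dotProduct, smul_dotProduct, hx]

/-- If `Γ k` is the dimension of the data space then a linear code with rank profile `Γ` has the
reconstruction property, and it sustains any number of repairs since these can keep the profile. -/
theorem sustains_of_rankProfile {F : Type} [Field F] {m n k d e a b : ℕ} {Γ : ℕ → ℕ}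
    (hΓ : IsRankProfile Γ d e a b) (hk : Γ k = m)
    (ha : 2 ^ n * 2 ^ (n * a) < Nat.card F) (hb : 2 ^ n * 2 ^ (n * b) < Nat.card F)
    {W X S : Type} (eW : W ≃ (Fin m → F)) (eX : (Fin a → F) ≃ X) (eS : (Fin b → F) ≃ S)
    (T : ℕ) (v : Fin n × Fin a → Fin m → F)
    (hv : ∀ A, Γ A.card ≤ Module.finrank F (nodeSpan F v A)) :
    Sustains k d e S T fun i w => eX fun l => v (i, l) ⬝ᵥ eW w := by
  have : Nonempty X := ⟨eX 0⟩
  have : Nonempty S := ⟨eS 0⟩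
  have hrec : ∀ v : Fin n × Fin a → Fin m → F,
      (∀ A, Γ A.card ≤ Module.finrank F (nodeSpan F v A)) →
      Reconstructs k fun i (w : W) => eX fun l => v (i, l) ⬝ᵥ eW w := by
    intro v hv K hK
    have htop : nodeSpan F v K = ⊤ := by
      refine Submodule.eq_top_of_finrank_eq (le_antisymm (Submodule.finrank_le _) ?_)
      have := hv K
      rw [hK, hk] at this
      rwa [Module.finrank_fin_fun]
    have hinj : Function.Injective fun (w : W) (i : K) => eX fun l => v (i, l) ⬝ᵥ eW w := by
      intro w w' hw
      refine eW.injective (funext fun t => ?_)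
      have h1 := dotProduct_eq_of_mem_nodeSpan (F := F) (v := v) (A := K) (x := Pi.single t 1)
        (w := eW w) (w' := eW w') (htop ▸ Submodule.mem_top)
        fun i hi => eX.injective (congrFun hw ⟨i, hi⟩)
      simpa using h1
    rcases isEmpty_or_nonempty W with hW | hW
    · exact (hW.false (eW.symm 0)).elim
    · exact ⟨Function.invFun _, Function.leftInverse_invFun hinj⟩
  induction T generalizing v with
  | zero => exact hrec v hv
  | succ T ih =>
    refine ⟨hrec v hv, fun E H hE hH _ => ?_⟩
    obtain ⟨s, v', hs, hfix, hnew, hv'⟩ := exists_repair_vectors hΓ ha hb v hv E H hE hH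
    refine ⟨_, isRepair_of_determined (fun i hi => ?_)
      (fun j w => eS fun l => s (j, l) ⬝ᵥ eW w) (fun j _ w w' h => ?_)
      (fun i hi w w' h => ?_), ih v' hv'⟩
    · simp only [hfix i hi]
    · refine congrArg eS (funext fun l => dotProduct_eq_of_mem_nodeSpan (hs j l) fun i hi => ?_)
      rw [Finset.mem_singleton.1 hi]
      exact eX.injective h
    · refine congrArg eX (funext fun l => dotProduct_eq_of_mem_nodeSpan (hnew i hi l)
        fun j hj => eS.injective (h j hj))

/-! ### The rank profile given by the minimum cut -/

/-- The cut value for node capacity `a`, helper capacity `b` and `D` helpers, in natural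
numbers. -/
def natCut (a b : ℕ) : ℕ → List ℕ → ℕ
  | _, [] => 0
  | D, u :: us => min (u * a) (D * b) + natCut a b (D - u) us

theorem natCut_append (a b : ℕ) (u v : List ℕ) (D : ℕ) :
    natCut a b D (u ++ v) = natCut a b D u + natCut a b (D - u.sum) v := by
  induction u generalizing D with
  | nil => simp [natCut]
  | cons x us ih => simp [natCut, ih, Nat.sub_sub, add_assoc]

theorem cutFrom_mul_eq_natCut (a b : ℕ) {t : ℝ} (ht : 0 ≤ t) (us : List ℕ) (D : ℕ)
    (h : us.sum ≤ D) : cutFrom (a * t) (b * t) D us = natCut a b D us * t := by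
  induction us generalizing D with
  | nil => simp [cutFrom, natCut]
  | cons u us ih =>
    rw [List.sum_cons] at h
    rw [cutFrom, natCut, ← Nat.cast_sub (by omega), ih _ (by omega)]
    push_cast
    rw [add_mul, min_mul_of_nonneg _ _ ht]
    simp only [mul_assoc]

/-- The minimum of the cut values of the scenarios for `y` nodes (there are such scenarios when
`1 ≤ e`). -/
def minCut (a b d e y : ℕ) : ℕ := sInf (natCut a b d '' scenarios y e)

section MinCut

variable {a b d e : ℕ}

theorem minCut_le {y : ℕ} {u : List ℕ} (hu : u ∈ scenarios y e) :
    minCut a b d e y ≤ natCut a b d u := Nat.sInf_le ⟨u, hu, rfl⟩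

theorem exists_natCut_eq_minCut (he : 1 ≤ e) (y : ℕ) :
    ∃ u ∈ scenarios y e, natCut a b d u = minCut a b d e y := by
  have hne : (natCut a b d '' scenarios y e).Nonempty :=
    ⟨_, List.replicate y 1, ⟨fun x hx => by
      rw [List.eq_of_mem_replicate hx]; exact ⟨le_rfl, he⟩, by simp⟩, rfl⟩
  exact Nat.sInf_mem hne

theorem minCut_add_le (he : 1 ≤ e) (y : ℕ) {u : ℕ} (hu : u ≤ e) :
    minCut a b d e (y + u) ≤ minCut a b d e y + min (u * a) ((d - y) * b) := by
  rcases Nat.eq_zero_or_pos u with rfl | hu0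
  · simp
  obtain ⟨l, hl, hcut⟩ := exists_natCut_eq_minCut (a := a) (b := b) (d := d) he y
  have hmem : l ++ [u] ∈ scenarios (y + u) e := by
    refine ⟨fun x hx => ?_, by simp [hl.2]⟩
    rcases List.mem_append.1 hx with hx | hx
    · exact hl.1 x hx
    · rw [List.mem_singleton.1 hx]; exact ⟨hu0, hu⟩
  refine (minCut_le hmem).trans (le_of_eq ?_)
  rw [natCut_append, hcut, hl.2]
  simp [natCut]

theorem minCut_mono (he : 1 ≤ e) : Monotone (minCut a b d e) := by
  refine monotone_nat_of_le_succ fun y => ?_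
  obtain ⟨l, hl, hcut⟩ := exists_natCut_eq_minCut (a := a) (b := b) (d := d) he (y + 1)
  rw [← hcut]
  -- the last part of the scenario is reduced by one, or omitted
  rcases List.eq_nil_or_concat l with rfl | ⟨l, x, rfl⟩
  · simpa using hl.2
  rw [List.concat_eq_append] at *
  have hsum : l.sum + x = y + 1 := by simpa using hl.2
  have hx := hl.1 x (by simp)
  have hl' : ∀ z ∈ l, 1 ≤ z ∧ z ≤ e := fun z hz => hl.1 z (by simp [hz])
  rw [natCut_append]
  rcases hx.1.eq_or_lt with rfl | hx1
  · exact (minCut_le ⟨hl', by omega⟩).trans (Nat.le_add_right _ _)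
  · have hmem : l ++ [x - 1] ∈ scenarios y e := by
      refine ⟨fun z hz => ?_, by rw [List.sum_append, List.sum_singleton]; omega⟩
      rcases List.mem_append.1 hz with hz | hz
      · exact hl' z hz
      · rw [List.mem_singleton.1 hz]; omega
    refine (minCut_le hmem).trans ?_
    rw [natCut_append]
    simp only [natCut, add_zero]
    exact Nat.add_le_add_left (min_le_min (Nat.mul_le_mul_right _ (Nat.sub_le _ _)) le_rfl) _

theorem isRankProfile_minCut (he : 1 ≤ e) (m k : ℕ) :
    IsRankProfile (fun y => min m (minCut a b d e (min y k))) d e a b := by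
  have hstep : ∀ y u, u ≤ e → min m (minCut a b d e (min (y + u) k)) ≤
      min m (minCut a b d e (min y k)) + min (u * a) ((d - y) * b) := by
    intro y u hu
    rcases le_total k y with hky | hky
    · rw [min_eq_right hky, min_eq_right (by omega : k ≤ y + u)]
      exact Nat.le_add_right _ _
    · have h1 := minCut_add_le (a := a) (b := b) (d := d) he y (u := min (y + u) k - y) (by omega)
      rw [Nat.add_sub_cancel' (by omega)] at h1
      have h2 : min ((min (y + u) k - y) * a) ((d - y) * b) ≤ min (u * a) ((d - y) * b) :=
        min_le_min (Nat.mul_le_mul_right _ (by omega)) le_rfl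
      rw [min_eq_left hky]
      omega
  refine ⟨fun y z h => min_le_min le_rfl (minCut_mono he (min_le_min h le_rfl)),
    fun y u hu => ?_, fun y u hu => ?_⟩
  · exact (hstep y u hu).trans (Nat.add_le_add_left (min_le_left _ _) _)
  · exact (hstep y u hu).trans (Nat.add_le_add_left (min_le_right _ _) _)

theorem minCut_zero : minCut a b d e 0 = 0 :=
  Nat.le_zero.1 (minCut_le (u := []) ⟨by simp, rfl⟩)

end MinCut

/-! ### Existence of codes -/

theorem exactCodeExists_of_forall_natCut (n k d e T m a b : ℕ) {t : ℝ} (ht : 0 < t)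
    (he : 1 ≤ e) (h : ∀ u ∈ scenarios k e, m ≤ natCut a b d u) :
    ExactCodeExists (m * t) n k d e (a * t) (b * t) T := by
  obtain ⟨p, hp, hprime⟩ :=
    Nat.exists_infinite_primes (2 ^ n * 2 ^ (n * a) + 2 ^ n * 2 ^ (n * b) + 1)
  have : Fact p.Prime := ⟨hprime⟩
  have hΓ := isRankProfile_minCut (a := a) (b := b) (d := d) he m k
  have hk : min m (minCut a b d e (min k k)) = m := by
    obtain ⟨u, hu, hcut⟩ := exists_natCut_eq_minCut (a := a) (b := b) (d := d) he k
    rw [min_self, ← hcut, min_eq_left (h u hu)]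
  have ha : 2 ^ n * 2 ^ (n * a) < Nat.card (ZMod p) := by rw [Nat.card_zmod]; omega
  have hb : 2 ^ n * 2 ^ (n * b) < Nat.card (ZMod p) := by rw [Nat.card_zmod]; omega
  obtain ⟨v, hv⟩ := exists_vectors_of_rankProfile (F := ZMod p) (V := Fin m → ZMod p) (n := n)
    hΓ he (by simp [minCut_zero]) (fun y => by simp) ha
  have hequiv : ∀ c : ℕ, Nonempty ((Fin c → ZMod p) ≃ Fin (p ^ c)) := fun c =>
    ⟨Fintype.equivFinOfCardEq (by simp [ZMod.card])⟩
  obtain ⟨eW⟩ := hequiv m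
  obtain ⟨eX⟩ := hequiv a
  obtain ⟨eS⟩ := hequiv b
  have hpow : ∀ c : ℕ, ((p : ℝ) ^ t⁻¹) ^ (c * t) = ((p ^ c : ℕ) : ℝ) := fun c => by
    rw [← Real.rpow_mul p.cast_nonneg, mul_left_comm, inv_mul_cancel₀ ht.ne', mul_one,
      Real.rpow_natCast, Nat.cast_pow]
  refine ⟨(p : ℝ) ^ t⁻¹, Real.one_lt_rpow (by exact_mod_cast hprime.one_lt) (inv_pos.2 ht),
    p ^ m, p ^ a, p ^ b, (hpow m).le, (hpow a).ge, (hpow b).ge, _,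
    sustains_of_rankProfile hΓ hk ha hb eW.symm eX eS T v hv⟩

theorem ExactCodeExists.mono {M M' α α' β β' : ℝ} {n k d e T : ℕ}
    (h : ExactCodeExists M n k d e α β T) (hM : M' ≤ M) (hα : α ≤ α') (hβ : β ≤ β') :
    ExactCodeExists M' n k d e α' β' T := by
  obtain ⟨b, hb, w, x, s, hw, hx, hs, hc⟩ := h
  exact ⟨b, hb, w, x, s, (Real.rpow_le_rpow_of_exponent_le hb.le hM).trans hw,
    hx.trans (Real.rpow_le_rpow_of_exponent_le hb.le hα),
    hs.trans (Real.rpow_le_rpow_of_exponent_le hb.le hβ), hc⟩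

theorem cutFrom_sub_le {α α' β β' t : ℝ} (ht : 0 ≤ t) (hα : α - t ≤ α') (hβ : β - t ≤ β')
    (us : List ℕ) (D : ℝ) (hD : ((us.sum : ℕ) : ℝ) ≤ D) :
    cutFrom α β D us - ((us.sum : ℕ) + us.length * D) * t ≤ cutFrom α' β' D us := by
  induction us generalizing D with
  | nil => simp [cutFrom]
  | cons u us ih =>
    rw [List.sum_cons, Nat.cast_add] at hD
    have hu : (0 : ℝ) ≤ u := u.cast_nonneg
    have hs : (0 : ℝ) ≤ (us.sum : ℕ) := Nat.cast_nonneg _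
    have hrec := ih (D - u) (by linarith)
    have hmin : min (u * α) (D * β) - (u + D) * t ≤ min (u * α') (D * β') := by
      have h1 := mul_le_mul_of_nonneg_left hα hu
      have h2 := mul_le_mul_of_nonneg_left hβ (by linarith : 0 ≤ D)
      have h3 := mul_nonneg hu ht
      have h4 := mul_nonneg (by linarith : 0 ≤ D) ht
      refine le_min ?_ ?_
      · have := min_le_left (u * α) (D * β)
        linarith
      · have := min_le_right (u * α) (D * β)
        linarith
    have h5 : 0 ≤ (us.length : ℝ) * u * t := by positivity
    rw [cutFrom, cutFrom, List.sum_cons, List.length_cons]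
    push_cast at hrec ⊢
    linarith

theorem codesExist_of_forall_le {M α β : ℝ} {n k d e T : ℕ} (hα : 0 ≤ α) (hβ : 0 ≤ β)
    (he : 1 ≤ e) (hkd : k ≤ d) (h : ∀ u ∈ scenarios k e, M ≤ cutValue d α β u) :
    CodesExist M n k d e α β T := by
  intro ε hε
  -- rounding `α` and `β` down to multiples of `t` costs at most `(k + k d) t`
  obtain ⟨t, ht, htε⟩ : ∃ t : ℝ, 0 < t ∧ ((k : ℝ) + k * d + 1) * t ≤ ε :=
    ⟨ε / ((k : ℝ) + k * d + 1), by positivity, (mul_div_cancel₀ ε (by positivity)).le⟩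
  have hfloor : ∀ γ : ℝ, 0 ≤ γ → (⌊γ / t⌋₊ : ℝ) * t ≤ γ ∧ γ - t ≤ ⌊γ / t⌋₊ * t := by
    intro γ hγ
    have h1 := Nat.floor_le (div_nonneg hγ ht.le)
    have h2 := Nat.lt_floor_add_one (γ / t)
    rw [le_div_iff₀ ht] at h1
    rw [div_lt_iff₀ ht] at h2
    exact ⟨h1, by linarith⟩
  refine (exactCodeExists_of_forall_natCut n k d e T ⌈(M - ε) / t⌉₊ ⌊α / t⌋₊ ⌊β / t⌋₊ ht he
    fun u hu => ?_).mono ?_ (hfloor α hα).1 (hfloor β hβ).1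
  · rcases le_total (M - ε) 0 with hM | hM
    · rw [Nat.ceil_eq_zero.2 (div_nonpos_of_nonpos_of_nonneg hM ht.le)]
      exact Nat.zero_le _
    have h1 := Nat.ceil_lt_add_one (div_nonneg hM ht.le)
    rw [← sub_lt_iff_lt_add, lt_div_iff₀ ht] at h1
    have hsum : ((u.sum : ℕ) : ℝ) ≤ d := by rw [hu.2]; exact_mod_cast hkd
    have h2 := cutFrom_sub_le ht.le (hfloor α hα).2 (hfloor β hβ).2 u d hsum
    rw [cutFrom_mul_eq_natCut _ _ ht.le u d (by rw [hu.2]; exact hkd), hu.2,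
      ← cutValue_eq_cutFrom] at h2
    have hlen : (u.length : ℝ) ≤ k := by
      rw [← hu.2]
      exact_mod_cast List.length_le_sum_of_one_le u fun x hx => (hu.1 x hx).1
    have h3 : (u.length : ℝ) * d * t ≤ k * d * t := by gcongr
    have h4 := h u hu
    have h5 : (⌈(M - ε) / t⌉₊ : ℝ) * t ≤ natCut ⌊α / t⌋₊ ⌊β / t⌋₊ d u * t := by
      linarith
    exact_mod_cast le_of_mul_le_mul_right h5 ht
  · rw [← div_le_iff₀ ht]
    exact Nat.le_ceil _

end CentralizedRepair

end

theorem theorem2 (M α β : ℝ) (n k d e : ℕ) (hα : 0 ≤ α) (hβ : 0 ≤ β)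
    (he : 1 ≤ e) (hk : 1 ≤ k) (hkd : k ≤ d) (hdn : d + e ≤ n) :
    -- the minimum of the cut value over all scenarios is attained at `u*`
    (CentralizedRepair.optimalScenario k d e α β ∈ CentralizedRepair.scenarios k e ∧
      ∀ u ∈ CentralizedRepair.scenarios k e,
        CentralizedRepair.cutValue d α β (CentralizedRepair.optimalScenario k d e α β) ≤
          CentralizedRepair.cutValue d α β u) ∧
    (CentralizedRepair.optimalScenario k d e α β).length = ⌈(k : ℝ) / (e : ℝ)⌉₊ ∧
    -- for every bound `T ≥ ⌈k / e⌉` on the number of repair rounds, codes exist iff `M ≤ f(u*)`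
    ∀ T : ℕ, ⌈(k : ℝ) / (e : ℝ)⌉₊ ≤ T →
      (CentralizedRepair.CodesExist M n k d e α β T ↔
        M ≤ CentralizedRepair.cutValue d α β (CentralizedRepair.optimalScenario k d e α β)) ∧
      -- and if the three amounts are integer multiples of one quantity, no loss is incurred
      ((∃ t : ℝ, 0 < t ∧ ∃ m a b : ℕ, M = m * t ∧ α = a * t ∧ β = b * t) →
        (CentralizedRepair.ExactCodeExists M n k d e α β T ↔
          M ≤ CentralizedRepair.cutValue d α β
            (CentralizedRepair.optimalScenario k d e α β))) := by
  have hmem := CentralizedRepair.optimalScenario_mem (d := d) α β he hk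
  have hmin : ∀ u ∈ CentralizedRepair.scenarios k e,
      CentralizedRepair.cutValue d α β (CentralizedRepair.optimalScenario k d e α β) ≤
        CentralizedRepair.cutValue d α β u := fun u hu =>
    CentralizedRepair.cutValue_optimalScenario_le hβ he hkd hu
  have hlen := CentralizedRepair.length_optimalScenario (d := d) α β he hk
  refine ⟨⟨hmem, hmin⟩, hlen, fun T hT => ?_⟩
  rw [← hlen] at hT
  refine ⟨⟨fun h => ?_, fun h => ?_⟩, ?_⟩
  · refine le_of_forall_pos_le_add fun ε hε => ?_
    have := (h ε hε).le_cutValue hkd hdn hmem hT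
    linarith
  · exact CentralizedRepair.codesExist_of_forall_le hα hβ he hkd fun u hu => h.trans (hmin u hu)
  · rintro ⟨t, ht, m, a, b, rfl, rfl, rfl⟩
    refine ⟨fun h => h.le_cutValue hkd hdn hmem hT, fun h => ?_⟩
    refine CentralizedRepair.exactCodeExists_of_forall_natCut n k d e T m a b ht he
      fun u hu => ?_
    have h1 := h.trans (hmin u hu)
    rw [CentralizedRepair.cutValue_eq_cutFrom, CentralizedRepair.cutFrom_mul_eq_natCut a b ht.le u d
      (by rw [hu.2]; exact hkd)] at h1
    exact_mod_cast le_of_mul_le_mul_right h1 ht
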